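/- Let $\mathbb K\in\{\mathbb R,\mathbb C\}$, let $X\neq\{0\}$ be a Banach space over $\mathbb K$, and let $(\Omega,\Sigma,\mu)$ be a finite measure space such that $\Sigma$ contains an infinite sequence of pairwise disjoint sets of positive measure. Let $P_1(\mu,X)$ be the normed space of all ($\mu$-a.e. classes of) strongly $\mu$-measurable functions $f:\Omega\to X$ that are Pettis integrable, i.e. $x^*f\in L_1(\mu)$ for every $x^*\in X^*$ and for every $E\in\Sigma$ there is $x_E\in X$ with $x^*(x_E)=\int_E x^*f\,d\mu$ for all $x^*\in X^*$, equipped with the semivariation norm $$\|f\|=\sup\Big\{\int_\Omega |x^*f(\omega)|\,d\mu(\omega)\;:\;x^*\in X^*,\ \|x^*\|\le 1\Big\}.$$ Then the completion $\widehat{P_1(\mu,X)}$ of $P_1(\mu,X)$ has a quotient isomorphic to $\ell_1$: there is a closed linear subspace $M$ of $\widehat{P_1(\mu,X)}$ such that $\widehat{P_1(\mu,X)}/M$ is linearly homeomorphic to $\ell_1$ (over $\mathbb K$). -/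

import Mathlib

open MeasureTheory

noncomputable section

/-- `f` is Pettis integrable: it is scalarly integrable, and every measurable set `E` has a
Pettis integral `x = ∫_E f dμ` in `X`. (Strong measurability is imposed separately.) -/
def PettisIntegrable (𝕜 : Type*) [RCLike 𝕜] {Ω X : Type*} [MeasurableSpace Ω]
    [NormedAddCommGroup X] [NormedSpace 𝕜 X] (f : Ω → X) (μ : Measure Ω) : Prop :=
  (∀ φ : StrongDual 𝕜 X, Integrable (fun ω => φ (f ω)) μ) ∧
    ∀ E : Set Ω, MeasurableSet E →
      ∃ x : X, ∀ φ : StrongDual 𝕜 X, φ x = ∫ ω in E, φ (f ω) ∂μ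

section

variable {𝕜 : Type*} [RCLike 𝕜] {Ω X : Type*} [MeasurableSpace Ω]
  [NormedAddCommGroup X] [NormedSpace 𝕜 X] {μ : Measure Ω}

theorem PettisIntegrable.congr {f g : Ω → X} (hf : PettisIntegrable 𝕜 f μ) (h : f =ᵐ[μ] g) :
    PettisIntegrable 𝕜 g μ := by
  have key : ∀ φ : StrongDual 𝕜 X, (fun ω => φ (f ω)) =ᵐ[μ] fun ω => φ (g ω) := fun φ =>
    h.fun_comp φ
  refine ⟨fun φ => (hf.1 φ).congr (key φ), fun E hE => ?_⟩
  obtain ⟨x, hx⟩ := hf.2 E hE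
  exact ⟨x, fun φ => (hx φ).trans (integral_congr_ae (ae_restrict_of_ae (key φ)))⟩

theorem PettisIntegrable.zero : PettisIntegrable 𝕜 (fun _ : Ω => (0 : X)) μ :=
  ⟨fun φ => by simp, fun E _ => ⟨0, fun φ => by simp⟩⟩

theorem PettisIntegrable.add {f g : Ω → X} (hf : PettisIntegrable 𝕜 f μ)
    (hg : PettisIntegrable 𝕜 g μ) : PettisIntegrable 𝕜 (fun ω => f ω + g ω) μ := by
  refine ⟨fun φ => by simp only [map_add]; exact (hf.1 φ).add (hg.1 φ), fun E hE => ?_⟩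
  obtain ⟨x, hx⟩ := hf.2 E hE
  obtain ⟨y, hy⟩ := hg.2 E hE
  refine ⟨x + y, fun φ => ?_⟩
  simp only [map_add, hx, hy]
  exact (integral_add (hf.1 φ).integrableOn (hg.1 φ).integrableOn).symm

theorem PettisIntegrable.smul {f : Ω → X} (c : 𝕜) (hf : PettisIntegrable 𝕜 f μ) :
    PettisIntegrable 𝕜 (fun ω => c • f ω) μ := by
  refine ⟨fun φ => by simp only [map_smul]; exact (hf.1 φ).smul c, fun E hE => ?_⟩
  obtain ⟨x, hx⟩ := hf.2 E hE
  refine ⟨c • x, fun φ => ?_⟩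
  simp only [map_smul, hx]
  exact (integral_smul c _).symm

variable (𝕜 X μ) in
/-- The linear space of `μ`-a.e. classes of strongly `μ`-measurable Pettis integrable
functions. -/
def pettisSubmodule : Submodule 𝕜 (Ω →ₘ[μ] X) where
  carrier := {f | PettisIntegrable 𝕜 f μ}
  zero_mem' := PettisIntegrable.zero.congr (AEEqFun.coeFn_zero (β := X)).symm
  add_mem' := fun {f g} hf hg => (PettisIntegrable.add hf hg).congr (AEEqFun.coeFn_add f g).symm
  smul_mem' := fun c f hf => (PettisIntegrable.smul c hf).congr (AEEqFun.coeFn_smul c f).symm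

variable (𝕜 X μ) in
/-- The space `P₁(μ, X)`, as a type of its own, to carry the semivariation norm. -/
def PettisP1 : Type _ := ↥(pettisSubmodule 𝕜 X μ)

namespace PettisP1

instance : AddCommGroup (PettisP1 𝕜 X μ) := inferInstanceAs (AddCommGroup (pettisSubmodule 𝕜 X μ))

instance : Module 𝕜 (PettisP1 𝕜 X μ) := inferInstanceAs (Module 𝕜 (pettisSubmodule 𝕜 X μ))

/-- The underlying `μ`-a.e. class of functions. -/
def toAEEqFun (f : PettisP1 𝕜 X μ) : Ω →ₘ[μ] X := Subtype.val f

/-- The semivariation norm `sup {∫ |x* f| dμ : ‖x*‖ ≤ 1}`. -/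
instance : Norm (PettisP1 𝕜 X μ) :=
  ⟨fun f => sSup {r : ℝ | ∃ φ : StrongDual 𝕜 X, ‖φ‖ ≤ 1 ∧ r = ∫ ω, ‖φ (f.toAEEqFun ω)‖ ∂μ}⟩

theorem norm_def (f : PettisP1 𝕜 X μ) : ‖f‖ =
    sSup {r : ℝ | ∃ φ : StrongDual 𝕜 X, ‖φ‖ ≤ 1 ∧ r = ∫ ω, ‖φ (f.toAEEqFun ω)‖ ∂μ} := rfl

theorem integrable (f : PettisP1 𝕜 X μ) (φ : StrongDual 𝕜 X) :
    Integrable (fun ω => φ (f.toAEEqFun ω)) μ := f.2.1 φ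

/-- The supremum defining the norm is finite. -/
theorem exists_bound (f : PettisP1 𝕜 X μ) :
    ∃ C : ℝ, ∀ φ : StrongDual 𝕜 X, ∫ ω, ‖φ (f.toAEEqFun ω)‖ ∂μ ≤ C * ‖φ‖ := by
  let T : StrongDual 𝕜 X →ₗ[𝕜] (Ω →₁[μ] 𝕜) :=
    { toFun := fun φ => (f.integrable φ).toL1 _
      map_add' := fun φ ψ => Integrable.toL1_add _ _ (f.integrable φ) (f.integrable ψ)
      map_smul' := fun c φ => Integrable.toL1_smul' _ (f.integrable φ) c }
  have hT : Continuous T := by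
    refine T.continuous_of_seq_closed_graph fun u x y hu hTu => ?_
    obtain ⟨ns, hns, hlim⟩ :=
      (tendstoInMeasure_of_tendsto_Lp (p := 1) hTu).exists_seq_tendsto_ae
    have h1 : ∀ᵐ ω ∂μ, ∀ n, (T (u n) : Ω → 𝕜) ω = u n (f.toAEEqFun ω) :=
      ae_all_iff.2 fun n => (f.integrable (u n)).coeFn_toL1
    have h2 : (T x : Ω → 𝕜) =ᵐ[μ] fun ω => x (f.toAEEqFun ω) := (f.integrable x).coeFn_toL1
    refine Lp.ext ?_
    filter_upwards [hlim, h1, h2] with ω hω hω1 hω2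
    rw [hω2]
    refine tendsto_nhds_unique (hω.congr fun n => hω1 (ns n)) ?_
    exact ((ContinuousLinearMap.apply 𝕜 𝕜 (f.toAEEqFun ω)).continuous.tendsto x).comp
      (hu.comp hns.tendsto_atTop)
  refine ⟨‖(⟨T, hT⟩ : StrongDual 𝕜 X →L[𝕜] (Ω →₁[μ] 𝕜))‖, fun φ => ?_⟩
  have h := (⟨T, hT⟩ : StrongDual 𝕜 X →L[𝕜] (Ω →₁[μ] 𝕜)).le_opNorm φ
  refine le_trans (le_of_eq ?_) h
  have h3 : ‖(f.integrable φ).toL1 _‖ = ∫ ω, ‖φ (f.toAEEqFun ω)‖ ∂μ := by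
    rw [L1.norm_eq_integral_norm]
    exact integral_congr_ae ((f.integrable φ).coeFn_toL1.fun_comp norm)
  exact h3.symm

theorem bddAbove (f : PettisP1 𝕜 X μ) : BddAbove
    {r : ℝ | ∃ φ : StrongDual 𝕜 X, ‖φ‖ ≤ 1 ∧ r = ∫ ω, ‖φ (f.toAEEqFun ω)‖ ∂μ} := by
  obtain ⟨C, hC⟩ := f.exists_bound
  refine ⟨|C|, ?_⟩
  rintro r ⟨φ, hφ, rfl⟩
  calc _ ≤ C * ‖φ‖ := hC φ
    _ ≤ |C| * ‖φ‖ := by gcongr; exact le_abs_self C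
    _ ≤ |C| * 1 := by gcongr
    _ = |C| := mul_one _

theorem le_norm (f : PettisP1 𝕜 X μ) {φ : StrongDual 𝕜 X} (hφ : ‖φ‖ ≤ 1) :
    ∫ ω, ‖φ (f.toAEEqFun ω)‖ ∂μ ≤ ‖f‖ := le_csSup f.bddAbove ⟨φ, hφ, rfl⟩

theorem norm_le (f : PettisP1 𝕜 X μ) {C : ℝ}
    (h : ∀ φ : StrongDual 𝕜 X, ‖φ‖ ≤ 1 → ∫ ω, ‖φ (f.toAEEqFun ω)‖ ∂μ ≤ C) : ‖f‖ ≤ C := by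
  refine csSup_le ⟨_, 0, by simp, rfl⟩ ?_
  rintro r ⟨φ, hφ, rfl⟩
  exact h φ hφ

theorem norm_nonneg' (f : PettisP1 𝕜 X μ) : 0 ≤ ‖f‖ :=
  le_trans (by simp) (f.le_norm (φ := 0) (by simp))

theorem norm_smul_le' (c : 𝕜) (f : PettisP1 𝕜 X μ) : ‖c • f‖ ≤ ‖c‖ * ‖f‖ := by
  refine norm_le _ fun φ hφ => ?_
  have h : ∫ ω, ‖φ ((c • f).toAEEqFun ω)‖ ∂μ = ‖c‖ * ∫ ω, ‖φ (f.toAEEqFun ω)‖ ∂μ := by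
    rw [← integral_const_mul]
    refine integral_congr_ae ?_
    filter_upwards [AEEqFun.coeFn_smul c f.toAEEqFun] with ω hω
    have : (c • f).toAEEqFun ω = c • f.toAEEqFun ω := hω
    rw [this, map_smul, norm_smul]
  rw [h]
  exact mul_le_mul_of_nonneg_left (f.le_norm hφ) (norm_nonneg c)

variable (𝕜 X μ) in
theorem normCore : NormedSpace.Core 𝕜 (PettisP1 𝕜 X μ) where
  norm_nonneg := norm_nonneg'
  norm_smul c f := by
    refine le_antisymm (norm_smul_le' c f) ?_
    by_cases hc : c = 0
    · subst hc; simpa using norm_nonneg' _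
    have h := norm_smul_le' c⁻¹ (c • f)
    rw [inv_smul_smul₀ hc, norm_inv] at h
    have hc' : 0 < ‖c‖ := norm_pos_iff.2 hc
    calc ‖c‖ * ‖f‖ ≤ ‖c‖ * (‖c‖⁻¹ * ‖c • f‖) := by gcongr
      _ = ‖c • f‖ := by field_simp
  norm_triangle f g := by
    refine norm_le _ fun φ hφ => ?_
    calc ∫ ω, ‖φ ((f + g).toAEEqFun ω)‖ ∂μ
        ≤ ∫ ω, (‖φ (f.toAEEqFun ω)‖ + ‖φ (g.toAEEqFun ω)‖) ∂μ := by
          refine integral_mono_ae ((f + g).integrable φ).norm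
            ((f.integrable φ).norm.add (g.integrable φ).norm) ?_
          filter_upwards [AEEqFun.coeFn_add f.toAEEqFun g.toAEEqFun] with ω hω
          have : (f + g).toAEEqFun ω = f.toAEEqFun ω + g.toAEEqFun ω := hω
          simp only [this, map_add]
          exact norm_add_le _ _
      _ = _ := integral_add (f.integrable φ).norm (g.integrable φ).norm
      _ ≤ ‖f‖ + ‖g‖ := add_le_add (f.le_norm hφ) (g.le_norm hφ)
  norm_eq_zero_iff f := by
    constructor
    · intro h
      have hzero : ∀ φ : StrongDual 𝕜 X, ‖φ‖ ≤ 1 →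
          ∀ᵐ ω ∂μ, φ (f.toAEEqFun ω) = 0 := fun φ hφ => by
        have h0 : ∫ ω, ‖φ (f.toAEEqFun ω)‖ ∂μ = 0 :=
          le_antisymm (h ▸ f.le_norm hφ) (integral_nonneg fun _ => norm_nonneg _)
        have h1 := (integral_eq_zero_iff_of_nonneg (fun _ => norm_nonneg _)
          (f.integrable φ).norm).1 h0
        filter_upwards [h1] with ω hω
        simpa using hω
      have hall : ∀ φ : StrongDual 𝕜 X, ∀ᵐ ω ∂μ, φ (f.toAEEqFun ω) = 0 := fun φ => by
        by_cases hφ : φ = 0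
        · subst hφ; simp
        have hn : (‖φ‖ : 𝕜) ≠ 0 := by simpa using hφ
        have := hzero ((‖φ‖ : 𝕜)⁻¹ • φ) (le_of_eq (norm_smul_inv_norm hφ))
        filter_upwards [this] with ω hω
        simpa [hφ] using hω
      obtain ⟨t, ht, hft⟩ := f.toAEEqFun.aestronglyMeasurable.isSeparable_ae_range
      have hae : f.toAEEqFun =ᵐ[μ] 0 := ae_eq_zero_of_forall_dual_of_isSeparable 𝕜 ht hall hft
      exact Subtype.ext (AEEqFun.ext (hae.trans AEEqFun.coeFn_zero.symm))
    · rintro rfl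
      have h := norm_smul_le' (0 : 𝕜) (0 : PettisP1 𝕜 X μ)
      rw [smul_zero, norm_zero, zero_mul] at h
      exact le_antisymm h (norm_nonneg' _)

instance : NormedAddCommGroup (PettisP1 𝕜 X μ) := NormedAddCommGroup.ofCore (normCore 𝕜 X μ)

instance : NormedSpace 𝕜 (PettisP1 𝕜 X μ) := NormedSpace.ofCore (normCore 𝕜 X μ)

end PettisP1

end

end

/-- The normed space `E` has a quotient, by a closed linear subspace, that is linearly
homeomorphic to `F`. -/
def HasQuotientIsomorphicTo (𝕜 E F : Type*) [RCLike 𝕜] [NormedAddCommGroup E] [NormedSpace 𝕜 E]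
    [NormedAddCommGroup F] [NormedSpace 𝕜 F] : Prop :=
  ∃ M : Submodule 𝕜 E, IsClosed (M : Set E) ∧ Nonempty ((E ⧸ M) ≃L[𝕜] F)

/-!
Fix `x ≠ 0` in `X`, a functional `φ` with `φ x = 1`, and disjoint sets `E i` with
`0 < μ (E i) < ∞`. Taking `f` to the family of integrals of `φ ∘ f` over the sets `E i` is a bounded
operator `P₁(μ, X) → ℓ₁`, as the composition `P₁(μ, X) → L₁(μ) → ℓ₁`. It sends the function equal to
`μ(E i)⁻¹ • x` on `E i` and to `0` elsewhere, whose semivariation norm is at most `‖x‖`, to the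
`i`-th unit vector of `ℓ₁`. The unit vectors thus have lifts that are uniformly bounded, so every
`a ∈ ℓ₁` lifts to the absolutely convergent series of the scaled lifts in the completion, and the
open mapping theorem identifies the quotient by the kernel with `ℓ₁`.
-/

theorem surjective_of_map_eq_lp_single_one {𝕜 E ι : Type*} [NormedField 𝕜]
    [NormedAddCommGroup E] [NormedSpace 𝕜 E] [CompleteSpace E] [DecidableEq ι]
    (T : E →L[𝕜] lp (fun _ : ι => 𝕜) 1) {e : ι → E} {C : ℝ} (he : ∀ i, ‖e i‖ ≤ C)
    (hT : ∀ i, T (e i) = lp.single 1 i 1) : Function.Surjective T := by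
  intro a
  have ha : Summable fun i => ‖a i‖ := by simpa using (lp.memℓp a).summable (by simp)
  have hsum : Summable fun i => a i • e i := by
    refine .of_norm_bounded (ha.mul_right C) fun i => ?_
    rw [norm_smul]
    gcongr
    exact he i
  have hTsum : HasSum (fun i => T (a i • e i)) a := by
    simpa [hT, ← lp.single_smul] using lp.hasSum_single ENNReal.one_ne_top a
  exact ⟨∑' i, a i • e i, (hsum.hasSum.mapL T).unique hTsum⟩

section Quotient

variable {𝕜 E F : Type*} [RCLike 𝕜] [NormedAddCommGroup E] [NormedSpace 𝕜 E]
  [NormedAddCommGroup F] [NormedSpace 𝕜 F]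

theorem HasQuotientIsomorphicTo.of_surjective [CompleteSpace E] [CompleteSpace F]
    (T : E →L[𝕜] F) (hT : Function.Surjective T) : HasQuotientIsomorphicTo 𝕜 E F := by
  have hker : IsClosed (T.ker : Set E) := T.isClosed_ker
  refine ⟨T.ker, hker, ⟨ContinuousLinearEquiv.ofBijective (T.ker.liftQL T le_rfl) ?_ ?_⟩⟩
  · rw [Submodule.toLinearMap_liftQL]
    exact Submodule.ker_liftQ_eq_bot _ _ _ le_rfl
  · rw [Submodule.toLinearMap_liftQL, Submodule.range_liftQ]
    exact LinearMap.range_eq_top.2 hT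

theorem HasQuotientIsomorphicTo.completion_lp_one {ι : Type*} [DecidableEq ι]
    (T : E →L[𝕜] lp (fun _ : ι => 𝕜) 1) {e : ι → E} {C : ℝ} (he : ∀ i, ‖e i‖ ≤ C)
    (hT : ∀ i, T (e i) = lp.single 1 i 1) :
    HasQuotientIsomorphicTo 𝕜 (UniformSpace.Completion E) (lp (fun _ : ι => 𝕜) 1) :=
  .of_surjective T.fromCompletion <|
    surjective_of_map_eq_lp_single_one T.fromCompletion (e := fun i => (e i : _))
      (fun i => (UniformSpace.Completion.norm_coe (e i)).trans_le (he i))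
      fun i => (T.fromCompletion_apply_coe (e i)).trans (hT i)

end Quotient

section SetIntegrals

variable {Ω ι F : Type*} [MeasurableSpace Ω] {μ : Measure Ω} [NormedAddCommGroup F]
  [NormedSpace ℝ F] {E : ι → Set Ω}

theorem sum_norm_setIntegral_le (hE : ∀ i, MeasurableSet (E i))
    (hd : Pairwise (Function.onFun Disjoint E)) {g : Ω → F} (hg : Integrable g μ) (s : Finset ι) :
    ∑ i ∈ s, ‖∫ ω in E i, g ω ∂μ‖ ≤ ∫ ω, ‖g ω‖ ∂μ :=
  calc ∑ i ∈ s, ‖∫ ω in E i, g ω ∂μ‖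
      ≤ ∑ i ∈ s, ∫ ω in E i, ‖g ω‖ ∂μ :=
        Finset.sum_le_sum fun _ _ => norm_integral_le_integral_norm _
    _ = ∫ ω in ⋃ i ∈ s, E i, ‖g ω‖ ∂μ :=
        (integral_biUnion_finset s (fun i _ => hE i) (hd.set_pairwise _)
          fun _ _ => hg.norm.integrableOn).symm
    _ ≤ ∫ ω, ‖g ω‖ ∂μ := setIntegral_le_integral hg.norm (.of_forall fun _ => norm_nonneg _)

variable (𝕜 : Type*) [NontriviallyNormedField 𝕜] [NormedSpace 𝕜 F] [SMulCommClass ℝ 𝕜 F]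

/-- The operator `g ↦ (∫_{E i} g dμ)ᵢ` from `L₁(μ, F)` to `ℓ₁(ι, F)`, for pairwise disjoint
measurable sets `E i`. -/
noncomputable def setIntegralsL1 (hE : ∀ i, MeasurableSet (E i))
    (hd : Pairwise (Function.onFun Disjoint E)) : (Ω →₁[μ] F) →L[𝕜] lp (fun _ : ι => F) 1 :=
  LinearMap.mkContinuous
    { toFun := fun g => ⟨fun i => ∫ ω in E i, g ω ∂μ, memℓp_gen' fun s => by
        simpa using sum_norm_setIntegral_le hE hd (L1.integrable_coeFn g) s⟩
      map_add' := fun g h => lp.ext <| funext fun i =>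
        (integral_congr_ae (ae_restrict_of_ae (Lp.coeFn_add g h))).trans <|
          integral_add (L1.integrable_coeFn g).integrableOn (L1.integrable_coeFn h).integrableOn
      map_smul' := fun c g => lp.ext <| funext fun _ =>
        (integral_congr_ae (ae_restrict_of_ae (Lp.coeFn_smul c g))).trans (integral_smul c _) }
    1 fun g => by
      refine lp.norm_le_of_forall_sum_le (by simp) (by positivity) fun s => ?_
      simpa [L1.norm_eq_integral_norm] using
        sum_norm_setIntegral_le hE hd (L1.integrable_coeFn g) s

theorem setIntegralsL1_apply (hE : ∀ i, MeasurableSet (E i))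
    (hd : Pairwise (Function.onFun Disjoint E)) (g : Ω →₁[μ] F) (i : ι) :
    setIntegralsL1 𝕜 hE hd g i = ∫ ω in E i, g ω ∂μ := rfl

theorem setIntegralsL1_indicatorConstLp [CompleteSpace F] [DecidableEq ι]
    (hE : ∀ i, MeasurableSet (E i)) (hd : Pairwise (Function.onFun Disjoint E)) {i : ι}
    (hμE : μ (E i) ≠ ⊤) (c : F) :
    setIntegralsL1 𝕜 hE hd (indicatorConstLp 1 (hE i) hμE c) =
      lp.single 1 i (μ.real (E i) • c) := by
  refine lp.ext <| funext fun j => ?_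
  rw [setIntegralsL1_apply, setIntegral_indicatorConstLp (hE j), lp.single_apply]
  obtain rfl | hij := eq_or_ne i j
  · simp
  · simp [(hd hij).inter_eq, hij.symm]

end SetIntegrals

section Pettis

variable {𝕜 : Type*} [RCLike 𝕜] {Ω X : Type*} [MeasurableSpace Ω]
  [NormedAddCommGroup X] [NormedSpace 𝕜 X] {μ : Measure Ω}

theorem PettisIntegrable.indicator_const {A : Set Ω} (hA : MeasurableSet A) (hμA : μ A ≠ ⊤)
    (x : X) : PettisIntegrable 𝕜 (A.indicator fun _ => x) μ := by
  have apply_indicator (φ : StrongDual 𝕜 X) :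
      (fun ω => φ (A.indicator (fun _ => x) ω)) = A.indicator fun _ => φ x :=
    (Set.indicator_comp_of_zero (map_zero φ)).symm
  refine ⟨fun φ => ?_, fun B _ => ⟨(μ.real (A ∩ B) : 𝕜) • x, fun φ => ?_⟩⟩
  · rw [apply_indicator]
    exact (integrable_indicator_iff hA).2 (integrableOn_const hμA)
  · rw [apply_indicator, integral_indicator_const _ hA, measureReal_restrict_apply hA, map_smul,
      RCLike.real_smul_eq_coe_smul (K := 𝕜)]

namespace PettisP1

theorem integral_norm_apply_le (f : PettisP1 𝕜 X μ) (φ : StrongDual 𝕜 X) :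
    ∫ ω, ‖φ (f.toAEEqFun ω)‖ ∂μ ≤ ‖φ‖ * ‖f‖ := by
  obtain rfl | hφ := eq_or_ne φ 0
  · simp
  have h := f.le_norm (φ := (‖φ‖ : 𝕜)⁻¹ • φ) (norm_smul_inv_norm hφ).le
  simp only [FunLike.coe_smul, Pi.smul_apply, norm_smul, norm_inv, RCLike.norm_ofReal, abs_norm,
    integral_const_mul] at h
  rwa [inv_mul_le_iff₀ (norm_pos_iff.2 hφ)] at h

/-- The operator `f ↦ φ ∘ f` from `P₁(μ, X)` to `L₁(μ)`, for `φ` in the dual of `X`. -/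
noncomputable def dualComp (φ : StrongDual 𝕜 X) : PettisP1 𝕜 X μ →L[𝕜] (Ω →₁[μ] 𝕜) :=
  LinearMap.mkContinuous
    { toFun := fun f => (f.integrable φ).toL1
      map_add' := fun f g => by
        rw [← Integrable.toL1_add, Integrable.toL1_eq_toL1_iff]
        filter_upwards [AEEqFun.coeFn_add f.toAEEqFun g.toAEEqFun] with ω hω
        exact (congrArg φ hω).trans (map_add φ _ _)
      map_smul' := fun c f => by
        rw [RingHom.id_apply, ← Integrable.toL1_smul', Integrable.toL1_eq_toL1_iff]
        filter_upwards [AEEqFun.coeFn_smul c f.toAEEqFun] with ω hω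
        exact (congrArg φ hω).trans (map_smul φ c _) }
    ‖φ‖ fun f =>
      (L1.norm_of_fun_eq_integral_norm (f.integrable φ)).trans_le (f.integral_norm_apply_le φ)

theorem coeFn_dualComp (φ : StrongDual 𝕜 X) (f : PettisP1 𝕜 X μ) :
    dualComp φ f =ᵐ[μ] fun ω => φ (f.toAEEqFun ω) :=
  (f.integrable φ).coeFn_toL1

theorem norm_dualComp (φ : StrongDual 𝕜 X) (f : PettisP1 𝕜 X μ) :
    ‖dualComp φ f‖ = ∫ ω, ‖φ (f.toAEEqFun ω)‖ ∂μ :=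
  L1.norm_of_fun_eq_integral_norm (f.integrable φ)

variable {A : Set Ω} (hA : MeasurableSet A) (hμA : μ A ≠ ⊤)

variable (𝕜) in
/-- The class in `P₁(μ, X)` of the function equal to `x` on `A` and to `0` elsewhere, for a
measurable set `A` of finite measure. -/
noncomputable def indicatorConst (x : X) : PettisP1 𝕜 X μ :=
  ⟨(indicatorConstLp 1 hA hμA x : Lp X 1 μ),
    (PettisIntegrable.indicator_const hA hμA x).congr indicatorConstLp_coeFn.symm⟩

theorem coeFn_indicatorConst (x : X) :
    (indicatorConst 𝕜 hA hμA x).toAEEqFun =ᵐ[μ] A.indicator fun _ => x :=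
  indicatorConstLp_coeFn (p := 1) (hs := hA) (hμs := hμA)

theorem dualComp_indicatorConst (φ : StrongDual 𝕜 X) (x : X) :
    dualComp φ (indicatorConst 𝕜 hA hμA x) = indicatorConstLp 1 hA hμA (φ x) := by
  refine Lp.ext ?_
  filter_upwards [coeFn_dualComp φ (indicatorConst 𝕜 hA hμA x),
    coeFn_indicatorConst (𝕜 := 𝕜) hA hμA x,
    indicatorConstLp_coeFn (p := 1) (hs := hA) (hμs := hμA) (c := φ x)] with ω hφ hx hφx
  rw [hφ, hx, hφx]
  exact congrFun (Set.indicator_comp_of_zero (map_zero φ)).symm ω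

theorem norm_indicatorConst_le (x : X) : ‖indicatorConst 𝕜 hA hμA x‖ ≤ μ.real A * ‖x‖ := by
  refine norm_le _ fun φ hφ => ?_
  calc ∫ ω, ‖φ ((indicatorConst 𝕜 hA hμA x).toAEEqFun ω)‖ ∂μ
      = ‖φ x‖ * μ.real A := by
        rw [← norm_dualComp, dualComp_indicatorConst,
          norm_indicatorConstLp one_ne_zero ENNReal.one_ne_top]
        simp
    _ ≤ ‖x‖ * μ.real A := by
        gcongr
        simpa using φ.le_of_opNorm_le hφ x
    _ = μ.real A * ‖x‖ := mul_comm _ _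

end PettisP1

end Pettis

theorem mainTheorem9_general {𝕜 : Type*} [RCLike 𝕜] {Ω ι : Type*} [MeasurableSpace Ω]
    {μ : Measure Ω} {E : ι → Set Ω} (hE : ∀ i, MeasurableSet (E i))
    (hd : Pairwise (Function.onFun Disjoint E)) (hpos : ∀ i, μ (E i) ≠ 0)
    (hfin : ∀ i, μ (E i) ≠ ⊤) (X : Type*) [NormedAddCommGroup X] [NormedSpace 𝕜 X]
    [Nontrivial X] :
    HasQuotientIsomorphicTo 𝕜 (UniformSpace.Completion (PettisP1 𝕜 X μ))
      (lp (fun _ : ι => 𝕜) 1) := by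
  classical
  obtain ⟨x, hx⟩ := exists_ne (0 : X)
  obtain ⟨φ, hφx⟩ := SeparatingDual.exists_eq_one (R := 𝕜) hx
  have hμE (i : ι) : μ.real (E i) ≠ 0 := measureReal_ne_zero_iff (hfin i) |>.2 (hpos i)
  let e (i : ι) : PettisP1 𝕜 X μ :=
    PettisP1.indicatorConst 𝕜 (hE i) (hfin i) ((μ.real (E i) : 𝕜)⁻¹ • x)
  have norm_e_le (i : ι) : ‖e i‖ ≤ ‖x‖ := by
    refine (PettisP1.norm_indicatorConst_le (hE i) (hfin i) _).trans_eq ?_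
    simp [norm_smul, abs_of_nonneg measureReal_nonneg, hμE i]
  refine .completion_lp_one (setIntegralsL1 𝕜 hE hd ∘L PettisP1.dualComp φ) norm_e_le fun i => ?_
  rw [ContinuousLinearMap.comp_apply, PettisP1.dualComp_indicatorConst,
    setIntegralsL1_indicatorConstLp, map_smul, hφx, RCLike.real_smul_eq_coe_smul (K := 𝕜),
    smul_inv_smul₀ (RCLike.ofReal_ne_zero.2 (hμE i))]

theorem mainTheorem9 {𝕜 : Type*} [RCLike 𝕜] {Ω : Type*} [MeasurableSpace Ω]
    (μ : Measure Ω) [IsFiniteMeasure μ]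
    (hμ : ∃ E : ℕ → Set Ω, (∀ n, MeasurableSet (E n)) ∧ Pairwise (Function.onFun Disjoint E) ∧
      ∀ n, 0 < μ (E n))
    (X : Type*) [NormedAddCommGroup X] [NormedSpace 𝕜 X] [CompleteSpace X] [Nontrivial X] :
    HasQuotientIsomorphicTo 𝕜 (UniformSpace.Completion (PettisP1 𝕜 X μ))
      (lp (fun _ : ℕ => 𝕜) 1) := by
  obtain ⟨E, hE, hd, hpos⟩ := hμ
  exact mainTheorem9_general hE hd (fun n => (hpos n).ne') (fun n => measure_ne_top μ (E n)) X
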